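/- A $\mathbf{BI}(\_)^\bullet$-algebra is a set $\mathcal A$ with a binary application $a\cdot b$ (written by juxtaposition, associating to the left), elements $\mathbf B,\mathbf I\in\mathcal A$ and an element $a^\bullet\in\mathcal A$ for each $a\in\mathcal A$, such that $\mathbf I\,a=a$, $\mathbf B\,a\,b\,c=a\,(b\,c)$ and $a^\bullet\,b=b\,a$. It is extensional if moreover, for all $a,b$, $$\mathbf B\,\mathbf I=\mathbf I,\qquad (a\,b)^\bullet=\mathbf B\,b^\bullet\,(\mathbf B\,a^\bullet\,\mathbf B),\qquad \mathbf B\,\mathbf B^\bullet\,(\mathbf B\,\mathbf B\,(\mathbf B\,\mathbf B\,\mathbf B))=\mathbf B\,(\mathbf B\,\mathbf B)\,\mathbf B,$$ $$\mathbf B\,\mathbf I^\bullet\,\mathbf B=\mathbf I,\qquad \mathbf B\,a^{\bullet\bullet}\,\mathbf B=\mathbf B\,(\mathbf B\,a^\bullet)\,\mathbf B .$$ Write $a\circ b=\mathbf B\,a\,b$, and let $\mathbf B^n$ be the $n$-fold composite $\mathbf B\circ\dots\circ\mathbf B$ (with $\mathbf B^0=\mathbf I$). In an extensional $\mathbf{BI}(\_)^\bullet$-algebra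 $\mathcal A$, an element $a$ has arity $m\to n$ if $a^\bullet\circ\mathbf B^{m+1}=(\mathbf B\,a)\circ\mathbf B^n$. Let $\mathcal C_{\mathcal A}$ be the strict monoidal category with objects the natural numbers, arrows $m\to n$ the elements of arity $m\to n$, the composite of $a:l\to m$ and $b:m\to n$ being $a\circ b$, identities $\mathbf I$, tensor product $m\otimes n=m+n$ on objects, and $a\otimes b=a\circ(\mathbf B^{n}b)$ for $a:m\to n$ and $b:m'\to n'$. Let $\mathcal D$ be a monoidal category with unit $I$ that is closed, i.e. for every object $X$ the functor $-\otimes X$ has a right adjoint $[X,-]$, and let $U$ be an object with an isomorphism $\varphi:U\cong[U,U]$. Let $\mathsf{app}:U\otimes U\to U$ be the transpose of $\varphi$, and for $t:X\otimes U\to U$ let $\lambda(t):X\to U$ be the transpose $X\to[U,U]$ of $t$ followed by $\varphi^{-1}$. The induced structure on the set $\mathcal D(I,U)$ is, up to the coherence isomorphisms of $\mathcal D$ and with $\circ$ now the usual composition of arrows of $\mathcal D$, $a\cdot b=\mathsf{app}\circ(a\otimes b)$, $\mathbf I=\lambda(\mathrm{id}_U)$, $\mathbf B=\lambda(\lambda(\lambda(\mathsf{app}\circ(U\otimes\mathsf{app}))))$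 and $a^\bullet=\lambda(\mathsf{app}\circ(U\otimes a))$. **Theorem.** For every extensional $\mathbf{BI}(\_)^\bullet$-algebra $\mathcal A$ there are a monoidal closed category $\mathcal D$ and an object $U$ of $\mathcal D$ with an isomorphism $U\cong[U,U]$ such that the induced structure on $\mathcal D(I,U)$ is an extensional $\mathbf{BI}(\_)^\bullet$-algebra, and it is isomorphic to $\mathcal A$ (by a bijection preserving application, $\mathbf B$, $\mathbf I$ and $(\_)^\bullet$). In fact one may take for $\mathcal D$ the presheaf category $\mathbf{Set}^{\mathcal C_{\mathcal A}^{\mathrm{op}}}$ with the Day convolution monoidal structure, and $U=\mathcal C_{\mathcal A}(-,1)$. -/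

import Mathlib

open CategoryTheory MonoidalCategory Opposite

universe u v w

namespace PlanarAlg

/-- The data of a `BI(_)•`-algebra: a total application, elements `B` and `I`, and an
element `a•` for every element `a`. -/
class BIBulletStr (A : Type u) where
  /-- the application `a · b` -/
  app : A → A → A
  /-- the combinator `B` -/
  B : A
  /-- the combinator `I` -/
  I : A
  /-- the operation `a ↦ a•` -/
  bul : A → A

open BIBulletStr

local infixl:70 " ⬝ " => BIBulletStr.app

/-- The composition `a ∘ b = B a b` (in diagrammatic reading: first `a`, then `b`). -/
def comp {A : Type u} [BIBulletStr A] (a b : A) : A := B ⬝ a ⬝ b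

local infixr:75 " ⊚ " => PlanarAlg.comp

/-- The laws of a `BI(_)•`-algebra. -/
class IsBIBulletAlgebra (A : Type u) [BIBulletStr A] : Prop where
  I_app (a : A) : I ⬝ a = a
  B_app (a b c : A) : B ⬝ a ⬝ b ⬝ c = a ⬝ (b ⬝ c)
  bul_app (a b : A) : bul a ⬝ b = b ⬝ a

/-- Extensional `BI(_)•`-algebras. -/
class IsExtensional (A : Type u) [BIBulletStr A] : Prop extends IsBIBulletAlgebra A where
  B_I : (B : A) ⬝ I = I
  app_bul (a b : A) : bul (a ⬝ b) = B ⬝ bul b ⬝ (B ⬝ bul a ⬝ B)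
  B_bul : (B : A) ⬝ bul B ⬝ (B ⬝ B ⬝ (B ⬝ B ⬝ B)) = B ⬝ (B ⬝ B) ⬝ B
  I_bul : (B : A) ⬝ bul I ⬝ B = I
  bul_bul (a : A) : B ⬝ bul (bul a) ⬝ B = B ⬝ (B ⬝ bul a) ⬝ B

/-- The power `B ∘ ⋯ ∘ B` (`n` factors), with `B⁰ = I`. -/
def powB (A : Type u) [BIBulletStr A] : ℕ → A
  | 0 => I
  | n + 1 => B ⊚ powB A n

/-- `a` is of arity `m → n` when `a• ∘ Bᵐ⁺¹ = (B a) ∘ Bⁿ`. -/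
def HasArity {A : Type u} [BIBulletStr A] (m n : ℕ) (a : A) : Prop :=
  bul a ⊚ powB A (m + 1) = (B ⬝ a) ⊚ powB A n

/-! ### Facts needed to see that the elements with an arity form a strict monoidal category -/

section Facts

open IsBIBulletAlgebra IsExtensional

variable {A : Type u} [BIBulletStr A] [IsExtensional A]

theorem comp_app (a b c : A) : (a ⊚ b) ⬝ c = a ⬝ (b ⬝ c) := B_app a b c

theorem I_comp (a : A) : I ⊚ a = a := by
  unfold comp; rw [B_I, I_app]

theorem comp_I (a : A) : a ⊚ I = a := by
  have h := congrArg (fun x : A => x ⬝ a) (I_bul (A := A))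
  simp only [B_app, bul_app, I_app] at h
  exact h

theorem B_comp (a b : A) : B ⬝ (a ⊚ b) = (B ⬝ a) ⊚ (B ⬝ b) := by
  have h := congrArg (fun x : A => x ⬝ a ⬝ b) (B_bul (A := A))
  simp only [B_app, bul_app] at h
  exact h.symm

theorem comp_assoc (a b c : A) : (a ⊚ b) ⊚ c = a ⊚ b ⊚ c := by
  have h := congrArg (fun x : A => x ⬝ c) (B_comp a b)
  simp only [comp_app] at h
  exact h

theorem comp_left_comm_of {a b c d : A} (h : a ⊚ b = c ⊚ d) (x : A) :
    a ⊚ b ⊚ x = c ⊚ d ⊚ x := by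
  rw [← comp_assoc, h, comp_assoc]

theorem powB_succ' (n : ℕ) : powB A (n + 1) = powB A n ⊚ B := by
  induction n with
  | zero => simp only [powB, I_comp, comp_I]
  | succ n ih =>
    change B ⊚ powB A (n + 1) = (B ⊚ powB A n) ⊚ B
    rw [comp_assoc, ← ih]

theorem powB_add_app (m n : ℕ) (a : A) :
    powB A (m + n) ⬝ a = powB A m ⬝ (powB A n ⬝ a) := by
  induction m with
  | zero => rw [Nat.zero_add, powB, I_app]
  | succ m ih =>
    rw [Nat.succ_add, powB, comp_app, ih, powB, comp_app]

theorem powB_I (n : ℕ) : powB A n ⬝ I = I := by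
  induction n with
  | zero => rw [powB, I_app]
  | succ n ih => rw [powB, comp_app, ih, B_I]

theorem powB_comp (n : ℕ) (a b : A) :
    powB A n ⬝ (a ⊚ b) = (powB A n ⬝ a) ⊚ (powB A n ⬝ b) := by
  induction n with
  | zero => simp only [powB, I_app]
  | succ n ih => simp only [powB, comp_app, ih, B_comp]

/-- The exchange law. -/
theorem HasArity.exchange {m n : ℕ} {a : A} (h : HasArity m n a) (b : A) :
    (powB A m ⬝ b) ⊚ a = a ⊚ (powB A n ⬝ b) := by
  have h' := congrArg (fun x : A => x ⬝ b) h
  simp only [comp_app, bul_app, powB] at h'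
  exact h'

theorem hasArity_I (n : ℕ) : HasArity n n (I : A) := by
  unfold HasArity
  rw [B_I, I_comp, powB, ← comp_assoc]
  have : bul I ⊚ B = (I : A) := I_bul
  rw [this, I_comp]

theorem hasArity_bul (a : A) : HasArity 0 1 (bul a) := by
  unfold HasArity
  simp only [powB, comp_I]
  exact bul_bul a

theorem hasArity_B : HasArity 2 1 (B : A) := by
  unfold HasArity
  simp only [powB, comp_I]
  exact B_bul

theorem bul_comp (a b : A) : bul (a ⊚ b) = bul b ⊚ bul a ⊚ bul B ⊚ B ⊚ B := by
  have h1 : bul (B ⬝ a ⬝ b) = bul b ⊚ bul (B ⬝ a) ⊚ B := app_bul _ _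
  have h2 : bul (B ⬝ a) = bul a ⊚ bul B ⊚ B := app_bul _ _
  rw [comp, h1, h2]
  simp only [comp_assoc]

theorem bul_exchange (a b : A) : bul a ⊚ (B ⬝ b) = b ⊚ bul a := by
  have h := (hasArity_bul a).exchange b
  simp only [powB, comp_I, I_app] at h
  exact h.symm

theorem B_exchange (b : A) : B ⊚ (B ⬝ b) = (B ⬝ (B ⬝ b)) ⊚ B := by
  have h := (hasArity_B (A := A)).exchange b
  simp only [powB, comp_I, comp_app] at h
  exact h.symm

theorem bul_B_comp (x : A) : bul B ⊚ B ⊚ B ⊚ B ⊚ x = (B ⬝ B) ⊚ B ⊚ x := by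
  have h : bul (B : A) ⊚ B ⊚ B ⊚ B = (B ⬝ B) ⊚ B := B_bul
  have h' := congrArg (fun y : A => y ⊚ x) h
  simp only [comp_assoc] at h'
  exact h'

theorem HasArity.comp {l m n : ℕ} {a b : A} (ha : HasArity l m a) (hb : HasArity m n b) :
    HasArity l n (a ⊚ b) := by
  unfold HasArity at *
  simp only [powB] at ha hb ⊢
  rw [bul_comp, B_comp]
  simp only [comp_assoc]
  rw [bul_B_comp, comp_left_comm_of (bul_exchange a B), ha,
    comp_left_comm_of (B_exchange a), comp_left_comm_of (bul_exchange b (B ⬝ a)), hb]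

theorem HasArity.B_app {m n : ℕ} {a : A} (h : HasArity m n a) :
    HasArity (m + 1) (n + 1) (B ⬝ a) := by
  unfold HasArity at *
  simp only [powB] at h ⊢
  have h2 : bul (B ⬝ a) = bul a ⊚ bul B ⊚ B := app_bul _ _
  rw [h2]
  simp only [comp_assoc]
  rw [bul_B_comp, comp_left_comm_of (bul_exchange a B), h, comp_left_comm_of (B_exchange a)]

theorem HasArity.succ {m n : ℕ} {a : A} (h : HasArity m n a) :
    HasArity (m + 1) (n + 1) a := by
  unfold HasArity at *
  rw [powB_succ' (m + 1), powB_succ' n, ← comp_assoc, h, comp_assoc]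

theorem HasArity.powB_app {m n : ℕ} {a : A} (h : HasArity m n a) (k : ℕ) :
    HasArity (k + m) (k + n) (powB A k ⬝ a) := by
  induction k with
  | zero => simpa only [Nat.zero_add, powB, I_app] using h
  | succ k ih =>
    rw [powB, comp_app, Nat.succ_add, Nat.succ_add]
    exact ih.B_app

theorem HasArity.add {m n : ℕ} {a : A} (h : HasArity m n a) (k : ℕ) :
    HasArity (m + k) (n + k) a := by
  induction k with
  | zero => exact h
  | succ k ih => exact ih.succ

theorem hasArity_I_of_eq {m n : ℕ} (h : m = n) : HasArity m n (I : A) := h ▸ hasArity_I m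

end Facts

/-! ### The monoidal category `C_A` -/

/-- The objects of `C_A`: the natural numbers. -/
structure PRO (A : Type u) : Type where
  /-- the underlying natural number -/
  num : ℕ

namespace PRO

variable {A : Type u} [BIBulletStr A]

/-- The arrows `m ⟶ n` of `C_A`: the elements of `A` of arity `m → n`. -/
@[ext]
structure Hom (m n : PRO A) : Type u where
  /-- the underlying element of `A` -/
  val : A
  hasArity : HasArity m.num n.num val

variable [IsExtensional A]

/-- Composition of arrows is `∘`, identities are `I`. -/
instance : Category.{u} (PRO A) where
  Hom m n := Hom m n
  id m := ⟨I, hasArity_I m.num⟩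
  comp f g := ⟨f.val ⊚ g.val, f.hasArity.comp g.hasArity⟩
  id_comp f := Hom.ext (I_comp f.val)
  comp_id f := Hom.ext (comp_I f.val)
  assoc f g h := Hom.ext (comp_assoc f.val g.val h.val)

@[ext]
theorem hom_ext {m n : PRO A} {f g : m ⟶ n} (h : Hom.val f = Hom.val g) : f = g := Hom.ext h

theorem id_val (m : PRO A) : Hom.val (𝟙 m) = I := rfl

theorem comp_val {l m n : PRO A} (f : l ⟶ m) (g : m ⟶ n) :
    Hom.val (f ≫ g) = Hom.val f ⊚ Hom.val g := rfl

/-- The identity arrow between equal natural numbers. -/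
def isoOfEq {m n : PRO A} (h : m.num = n.num) : m ≅ n where
  hom := ⟨I, hasArity_I_of_eq h⟩
  inv := ⟨I, hasArity_I_of_eq h.symm⟩
  hom_inv_id := hom_ext (I_comp I)
  inv_hom_id := hom_ext (I_comp I)

/-- The strict monoidal structure: addition on objects; adding `k` strands on the left of `f`
is `Bᵏ f`, adding `k` strands on the right of `f` is `f` itself, and all structural
isomorphisms are identities. -/
instance : MonoidalCategoryStruct (PRO A) where
  tensorObj m n := ⟨m.num + n.num⟩
  whiskerLeft k _ _ f := ⟨powB A k.num ⬝ f.val, f.hasArity.powB_app k.num⟩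
  whiskerRight f k := ⟨f.val, f.hasArity.add k.num⟩
  tensorUnit := ⟨0⟩
  associator l m n := isoOfEq (Nat.add_assoc l.num m.num n.num)
  leftUnitor m := isoOfEq (Nat.zero_add m.num)
  rightUnitor m := isoOfEq (Nat.add_zero m.num)

theorem whiskerLeft_val (k : PRO A) {m n : PRO A} (f : m ⟶ n) :
    Hom.val (k ◁ f) = powB A k.num ⬝ Hom.val f := rfl

theorem whiskerRight_val {m n : PRO A} (f : m ⟶ n) (k : PRO A) :
    Hom.val (f ▷ k) = Hom.val f := rfl

theorem tensorObj_num (m n : PRO A) : (m ⊗ n).num = m.num + n.num := rfl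

theorem tensorUnit_num : (𝟙_ (PRO A)).num = 0 := rfl

theorem associator_hom_val (l m n : PRO A) : Hom.val (α_ l m n).hom = I := rfl

theorem leftUnitor_hom_val (m : PRO A) : Hom.val (λ_ m).hom = I := rfl

theorem rightUnitor_hom_val (m : PRO A) : Hom.val (ρ_ m).hom = I := rfl

theorem tensorHom_val {m n m' n' : PRO A} (f : m ⟶ n) (g : m' ⟶ n') :
    Hom.val (f ⊗ₘ g) = Hom.val f ⊚ (powB A n.num ⬝ Hom.val g) := rfl

instance : MonoidalCategory (PRO A) where
  tensorHom_def _ _ := rfl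
  id_tensorHom_id m n := by
    ext; simp only [tensorHom_val, id_val, powB_I, comp_I]
  tensorHom_comp_tensorHom {X₁ Y₁ Z₁ X₂ Y₂ Z₂} f₁ f₂ g₁ g₂ := by
    ext
    simp only [tensorHom_val, comp_val, comp_assoc, powB_comp]
    rw [comp_left_comm_of ((Hom.hasArity g₁).exchange (Hom.val f₂))]
  whiskerLeft_id m n := by
    ext; simp only [whiskerLeft_val, id_val, powB_I]
  id_whiskerRight m n := rfl
  associator_naturality f₁ f₂ f₃ := by
    ext
    simp only [tensorHom_val, comp_val, comp_assoc, powB_comp, associator_hom_val, comp_I,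
      I_comp, tensorObj_num, powB_add_app]
  leftUnitor_naturality f := by
    ext
    simp only [comp_val, whiskerLeft_val, leftUnitor_hom_val, comp_I, I_comp, tensorUnit_num,
      powB, IsBIBulletAlgebra.I_app]
  rightUnitor_naturality f := by
    ext
    simp only [comp_val, whiskerRight_val, rightUnitor_hom_val, comp_I, I_comp]
  pentagon k l m n := by
    ext
    simp only [comp_val, whiskerRight_val, whiskerLeft_val, associator_hom_val, comp_I, powB_I]
  triangle m n := by
    ext
    simp only [comp_val, whiskerRight_val, whiskerLeft_val, associator_hom_val,
      leftUnitor_hom_val, rightUnitor_hom_val, comp_I, powB_I]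

end PRO

/-- The presheaf category `[C_Aᵒᵖ, Set]` with the Day convolution monoidal structure. -/
abbrev Presheaf (A : Type u) [BIBulletStr A] [IsExtensional A] :=
  DayFunctor (PRO A)ᵒᵖ (Type u)

/-- The representable presheaf `C_A(-, 1)`. -/
def reprOne (A : Type u) [BIBulletStr A] [IsExtensional A] : Presheaf A :=
  DayFunctor.mk (yoneda.obj (⟨1⟩ : PRO A))

/-! ### The algebra induced by an object `U ≅ [U, U]` of a monoidal closed category -/

/-- A closed structure on a monoidal category: for every object `X`, an internal hom functor
`[X, -]` right adjoint to `- ⊗ X`, so that maps `Y ⊗ X ⟶ Z` correspond to maps `Y ⟶ [X, Z]`. -/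
structure ClosedStr (D : Type v) [Category.{w} D] [MonoidalCategory D] where
  /-- the internal hom functor `[X, -]` -/
  ihom : D → D ⥤ D
  /-- the adjunction between `- ⊗ X` and `[X, -]` -/
  adj (X : D) : tensorRight X ⊣ ihom X

namespace ClosedStr

variable {D : Type v} [Category.{w} D] [MonoidalCategory D] (H : ClosedStr D)
  {U : D} (φ : U ≅ (H.ihom U).obj U)

/-- The application map `U ⊗ U ⟶ U`, the transpose of `φ : U ⟶ [U, U]`. -/
def appHom : U ⊗ U ⟶ U := ((H.adj U).homEquiv U U).symm φ.hom

/-- The abstraction `X ⟶ U` of a map `X ⊗ U ⟶ U`: its transpose `X ⟶ [U, U]` followed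
by `φ⁻¹`. -/
def lam {X : D} (t : X ⊗ U ⟶ U) : X ⟶ U := (H.adj U).homEquiv X U t ≫ φ.inv

/-- The induced structure on `D(I, U)`: writing `app(f, g)` for `(f ⊗ g) ≫ appHom`,
`a · b = app(a, b)`, `I = λ(id)`, `B = λ(λ(λ(app(id, app(id, id)))))` and
`a• = λ(app(id, a))`. -/
@[reducible]
def inducedStr : BIBulletStr (𝟙_ D ⟶ U) where
  app a b := (λ_ (𝟙_ D)).inv ≫ (a ⊗ₘ b) ≫ H.appHom φ
  I := H.lam φ (λ_ U).hom
  B := H.lam φ (H.lam φ (H.lam φ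
    (((λ_ U).hom ▷ U) ▷ U ≫ (α_ U U U).hom ≫ U ◁ H.appHom φ ≫ H.appHom φ)))
  bul a := H.lam φ ((λ_ U).hom ≫ (ρ_ U).inv ≫ U ◁ a ≫ H.appHom φ)

end ClosedStr

/-- Isomorphisms of `BI(_)•`-algebras: bijections that preserve the whole structure. -/
structure AlgIso (A : Type u) (A' : Type v) [BIBulletStr A] [BIBulletStr A'] extends
    A ≃ A' where
  map_app (a b : A) : toFun (a ⬝ b) = toFun a ⬝ toFun b
  map_B : toFun B = B
  map_I : toFun I = I
  map_bul (a : A) : toFun (bul a) = bul (toFun a)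

end PlanarAlg

/-! Every hom-set `C_A(m, 1)` is a copy of `A`: an arrow `x` has the code `x · I`, and `a` is the
code of the unique arrow `a• ∘ Bᵐ` (`HasArity.eq_bul_comp_powB`, `codeEquiv`). For Day convolution,
`[U, U](m)` consists of the natural maps `U ⟶ U(m ⊗ -)`. By Yoneda this is `C_A(m + 1, 1)`, again a
copy of `A`. The arrow `B : 2 ⟶ 1` gives a map `U ⊗ U ⟶ U` whose transpose `U ⟶ [U, U]` becomes `x ↦
x ∘ B`. Since `(x ∘ B) · I = x · (B · I) = x · I`, it preserves codes, hence is bijective at every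
`m`. This is the isomorphism `U ≅ [U, U]`. Maps from the unit to `U` are elements of `C_A(0, 1)`, so
they too are coded by `A`. Two rules show that codes respect the structure: the code of `app(x, y)`
is `x · y` (`elt_reprApp_app_I`), and the code of `λ(t)` at `x` is that of `t` at `x` and the
identity of `1` (`elt_lam_app_I`). The extensional laws are equations, so they transfer along the
resulting isomorphism. -/

namespace PlanarAlg

open LawfulDayConvolutionMonoidalCategoryStruct

/-! ### Day convolution through elements, and its closed structure -/

noncomputable section DayElements

variable {C : Type} [Category.{u} C] [MonoidalCategory C]

theorem types_congr_hom {X Y : Type u} {f g : X ⟶ Y} (h : f = g) (x : X) : f x = g x := by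
  rw [h]

/-- The image in the Day convolution `F ⊗ G` of a pair of elements of `F` and `G`. -/
def pair {F G : DayFunctor C (Type u)} {c d : C} (x : F.functor.obj c) (y : G.functor.obj d) :
    (F ⊗ G).functor.obj (c ⊗ d) :=
  (DayFunctor.η F G).app (c, d) (Prod.mk x y)

/-- The generating element of the unit for Day convolution. -/
def unitElt (C : Type) [Category.{u} C] [MonoidalCategory C] :
    (𝟙_ (DayFunctor C (Type u))).functor.obj (𝟙_ C) :=
  DayFunctor.ν C (Type u) PUnit.unit

section

variable {F F' G G' H : DayFunctor C (Type u)} {c c' d d' e : C}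

theorem tensor_map_pair (f : c ⟶ c') (g : d ⟶ d') (x : F.functor.obj c) (y : G.functor.obj d) :
    (F ⊗ G).functor.map (f ⊗ₘ g) (pair x y) = pair (F.functor.map f x) (G.functor.map g y) := by
  have h := types_congr_hom
    ((DayFunctor.η F G).naturality (X := (c, d)) (Y := (c', d')) (Prod.mkHom f g)) (Prod.mk x y)
  exact h.symm

/-- Day convolution is a left Kan extension of the external product, so the pairs generate it. All
later identities between maps out of a tensor product are checked on pairs. -/
theorem tensor_ext {α β : F ⊗ G ⟶ H}
    (h : ∀ (c d : C) (x : F.functor.obj c) (y : G.functor.obj d),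
      α.natTrans.app (c ⊗ d) (pair x y) = β.natTrans.app (c ⊗ d) (pair x y)) : α = β :=
  DayFunctor.tensor_hom_ext fun c d => by
    ext ⟨x, y⟩
    exact h c d x y

theorem tensorHom_pair (f : F ⟶ F') (g : G ⟶ G') (x : F.functor.obj c) (y : G.functor.obj d) :
    (f ⊗ₘ g).natTrans.app (c ⊗ d) (pair x y) =
      pair (f.natTrans.app c x) (g.natTrans.app d y) :=
  types_congr_hom (convolutionExtensionUnit_comp_ι_map_tensorHom_app
    C (Type u) f g c d) (Prod.mk x y)

theorem whiskerLeft_pair (g : G ⟶ G') (x : F.functor.obj c) (y : G.functor.obj d) :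
    (F ◁ g).natTrans.app (c ⊗ d) (pair x y) = pair x (g.natTrans.app d y) :=
  types_congr_hom (convolutionExtensionUnit_comp_ι_map_whiskerLeft_app
    (C := C) (Type u) F g c d) (Prod.mk x y)

theorem whiskerRight_pair (f : F ⟶ F') (x : F.functor.obj c) (y : G.functor.obj d) :
    (f ▷ G).natTrans.app (c ⊗ d) (pair x y) = pair (f.natTrans.app c x) y :=
  types_congr_hom (convolutionExtensionUnit_comp_ι_map_whiskerRight_app
    C (Type u) f G c d) (Prod.mk x y)

/-- The two nested pairs live over differently bracketed objects; the inverse associator of `C`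
carries the right-hand one over `(c ⊗ d) ⊗ e`. The unitors below need the same correction. -/
theorem associator_pair (x : F.functor.obj c) (y : G.functor.obj d) (z : H.functor.obj e) :
    (α_ F G H).hom.natTrans.app ((c ⊗ d) ⊗ e) (pair (pair x y) z) =
      (F ⊗ G ⊗ H).functor.map (α_ c d e).inv (pair x (pair y z)) :=
  types_congr_hom (associator_hom_unit_unit
    (C := C) (Type u) F G H c d e) (Prod.mk (Prod.mk x y) z)

theorem leftUnitor_pair (x : F.functor.obj c) :
    (λ_ F).hom.natTrans.app (𝟙_ C ⊗ c) (pair (unitElt C) x) = F.functor.map (λ_ c).inv x :=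
  types_congr_hom (leftUnitor_hom_unit_app (C := C) (Type u) F c) (Prod.mk PUnit.unit x)

theorem rightUnitor_pair (x : F.functor.obj c) :
    (ρ_ F).hom.natTrans.app (c ⊗ 𝟙_ C) (pair x (unitElt C)) = F.functor.map (ρ_ c).inv x :=
  types_congr_hom (rightUnitor_hom_unit_app (C := C) (Type u) F c) (Prod.mk x PUnit.unit)

end

/-- Maps out of the unit for Day convolution are elements over the unit object. -/
def unitHomEquiv (F : DayFunctor C (Type u)) :
    (𝟙_ (DayFunctor C (Type u)) ⟶ F) ≃ F.functor.obj (𝟙_ C) where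
  toFun f := f.natTrans.app (𝟙_ C) (unitElt C)
  invFun x := DayFunctor.unitDesc (↾fun _ => x)
  left_inv f := DayFunctor.unit_hom_ext <| by
    rw [DayFunctor.ν_comp_unitDesc]
    ext ⟨⟩
    rfl
  right_inv x := types_congr_hom
    (DayFunctor.ν_comp_unitDesc (C := C) (V := Type u) (F := F) (↾fun _ => x)) PUnit.unit

/-- The internal hom `[F, H]` for Day convolution: its value at `c` is the set of natural
transformations `F ⟶ H (c ⊗ -)`. -/
def internalHom (F H : DayFunctor C (Type u)) : DayFunctor C (Type u) where
  functor :=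
    -- These natural transformations form a type in `Type u` because the objects of `C` lie in
    -- `Type`.
    { obj c := F.functor ⟶ tensorLeft c ⋙ H.functor
      map f := ↾fun α => α ≫ Functor.whiskerRight ((tensoringLeft C).map f) H.functor }

theorem natTrans_app_map {F G : DayFunctor C (Type u)} (f : F ⟶ G) {c d : C} (g : c ⟶ d)
    (x : F.functor.obj c) :
    f.natTrans.app d (F.functor.map g x) = G.functor.map g (f.natTrans.app c x) :=
  types_congr_hom (f.natTrans.naturality g) x

/-- The natural transformation `y ↦ t (x, y)` for `t : G ⊗ F ⟶ H` and an element `x` of `G`. -/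
def partialApp {F G H : DayFunctor C (Type u)} (t : G ⊗ F ⟶ H) {c : C} (x : G.functor.obj c) :
    F.functor ⟶ tensorLeft c ⋙ H.functor where
  app d := ↾fun y => t.natTrans.app (c ⊗ d) (pair x y)
  naturality d d' g := by
    ext y
    change t.natTrans.app (c ⊗ d') (pair x (F.functor.map g y)) =
      H.functor.map (c ◁ g) (t.natTrans.app (c ⊗ d) (pair x y))
    rw [← natTrans_app_map, ← id_tensorHom, tensor_map_pair, Functor.map_id_apply]

/-- Joint naturality in both variables is what makes the uncurried family descend to the Day
convolution `G ⊗ F`. -/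
theorem internalHom_app_naturality {F G H : DayFunctor C (Type u)} (s : G ⟶ internalHom F H)
    {c c' d d' : C} (f : c ⟶ c') (g : d ⟶ d') (x : G.functor.obj c) (y : F.functor.obj d) :
    NatTrans.app (F := F.functor) (G := tensorLeft c' ⋙ H.functor)
        (s.natTrans.app c' (G.functor.map f x)) d' (F.functor.map g y) =
      H.functor.map (f ⊗ₘ g) (NatTrans.app (F := F.functor) (G := tensorLeft c ⋙ H.functor)
        (s.natTrans.app c x) d y) := by
  have h := types_congr_hom (NatTrans.naturality (F := F.functor)
    (G := tensorLeft c' ⋙ H.functor) (s.natTrans.app c' (G.functor.map f x)) g) y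
  refine h.trans ?_
  rw [natTrans_app_map, MonoidalCategory.tensorHom_def, Functor.map_comp]
  rfl

/-- Maps `G ⊗ F ⟶ H` correspond to maps `G ⟶ [F, H]`. -/
def internalHomEquiv (F G H : DayFunctor C (Type u)) :
    (G ⊗ F ⟶ H) ≃ (G ⟶ internalHom F H) where
  toFun t := .mk
    { app c := ↾fun x => partialApp t x
      naturality c c' f := by
        ext x
        refine NatTrans.ext (funext fun d => ?_)
        ext y
        change t.natTrans.app (c' ⊗ d) (pair (G.functor.map f x) y) =
          H.functor.map (f ▷ d) (t.natTrans.app (c ⊗ d) (pair x y))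
        rw [← natTrans_app_map, ← tensorHom_id, tensor_map_pair, Functor.map_id_apply] }
  invFun s := DayFunctor.tensorDesc
    { app p := ↾fun z => NatTrans.app (F := F.functor) (G := tensorLeft p.1 ⋙ H.functor)
        (s.natTrans.app p.1 z.1) p.2 z.2
      naturality p q f := by
        ext z
        exact internalHom_app_naturality s f.1 f.2 z.1 z.2 }
  left_inv t := tensor_ext fun c d x y =>
    types_congr_hom (DayFunctor.η_comp_tensorDesc_app (C := C) (V := Type u) _ c d) (Prod.mk x y)
  right_inv s := by
    refine DayFunctor.hom_ext (NatTrans.ext (funext fun c => ?_))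
    ext x
    refine NatTrans.ext (funext fun d => ?_)
    ext y
    exact types_congr_hom (DayFunctor.η_comp_tensorDesc_app (C := C) (V := Type u) _ c d)
      (Prod.mk x y)

variable (C) in
/-- The closed structure on presheaves with Day convolution. -/
def dayClosedStr : ClosedStr (DayFunctor C (Type u)) where
  ihom F := Adjunction.rightAdjointOfEquiv (F := tensorRight F)
    (fun G H => internalHomEquiv F G H) fun G' G H f t => by
      refine DayFunctor.hom_ext (NatTrans.ext (funext fun c => ?_))
      ext x
      refine NatTrans.ext (funext fun d => ?_)
      ext y
      exact congrArg (t.natTrans.app (c ⊗ d)) (whiskerRight_pair f x y)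
  adj F := Adjunction.adjunctionOfEquivRight _ _

theorem dayClosedStr_homEquiv (F G H : DayFunctor C (Type u)) (t : G ⊗ F ⟶ H) :
    ((dayClosedStr C).adj F).homEquiv G H t = internalHomEquiv F G H t := by
  simp [dayClosedStr, Adjunction.adjunctionOfEquivRight]
  rfl

end DayElements

open BIBulletStr

local infixl:70 " ⬝ " => BIBulletStr.app

local infixr:75 " ⊚ " => PlanarAlg.comp

/-! ### Transport of the extensional laws along isomorphisms -/

section Transfer

variable {A : Type u} {A' : Type v} [BIBulletStr A] [BIBulletStr A']

theorem AlgIso.apply_app (e : AlgIso A A') (a b : A) :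
    e.toEquiv (a ⬝ b) = e.toEquiv a ⬝ e.toEquiv b := e.map_app a b

theorem AlgIso.apply_B (e : AlgIso A A') : e.toEquiv B = B := e.map_B

theorem AlgIso.apply_I (e : AlgIso A A') : e.toEquiv I = I := e.map_I

theorem AlgIso.apply_bul (e : AlgIso A A') (a : A) :
    e.toEquiv (bul a) = bul (e.toEquiv a) := e.map_bul a

/-- The inverse of an isomorphism of `BI(_)•`-algebras. -/
def AlgIso.symm (e : AlgIso A A') : AlgIso A' A where
  toEquiv := e.toEquiv.symm
  map_app a b := e.toEquiv.symm_apply_eq.2 <| by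
    refine Eq.trans ?_ (e.map_app _ _).symm
    exact congrArg₂ app (e.toEquiv.apply_symm_apply a).symm (e.toEquiv.apply_symm_apply b).symm
  map_B := e.toEquiv.symm_apply_eq.2 e.map_B.symm
  map_I := e.toEquiv.symm_apply_eq.2 e.map_I.symm
  map_bul a := e.toEquiv.symm_apply_eq.2 <| by
    refine Eq.trans ?_ (e.map_bul _).symm
    exact congrArg bul (e.toEquiv.apply_symm_apply a).symm

/-- An algebra isomorphic to an extensional `BI(_)•`-algebra is one. -/
theorem IsExtensional.of_algIso [IsExtensional A'] (e : AlgIso A A') : IsExtensional A where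
  I_app a := e.toEquiv.injective <| by
    simp only [e.apply_app, e.apply_I, IsBIBulletAlgebra.I_app]
  B_app a b c := e.toEquiv.injective <| by
    simp only [e.apply_app, e.apply_B, IsBIBulletAlgebra.B_app]
  bul_app a b := e.toEquiv.injective <| by
    simp only [e.apply_app, e.apply_bul, IsBIBulletAlgebra.bul_app]
  B_I := e.toEquiv.injective <| by
    simp only [e.apply_app, e.apply_B, e.apply_I, B_I]
  app_bul a b := e.toEquiv.injective <| by
    simp only [e.apply_app, e.apply_B, e.apply_bul, app_bul]
  B_bul := e.toEquiv.injective <| by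
    simp only [e.apply_app, e.apply_B, e.apply_bul, B_bul]
  I_bul := e.toEquiv.injective <| by
    simp only [e.apply_app, e.apply_B, e.apply_I, e.apply_bul, I_bul]
  bul_bul a := e.toEquiv.injective <| by
    simp only [e.apply_app, e.apply_B, e.apply_bul, bul_bul]

end Transfer

/-! ### Arrows `m ⟶ 1` are coded by elements of the algebra -/

section Arity

open IsBIBulletAlgebra

variable {A : Type u} [BIBulletStr A] [IsExtensional A]

/-- `Bᵐ` is iterated application: `Bᵐ` with a spare strand on the right goes `m + 2 ⟶ 2`, and a last
`B : 2 ⟶ 1` consumes that strand. -/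
theorem hasArity_powB (m : ℕ) : HasArity (m + 1) 1 (powB A m) := by
  induction m with
  | zero => exact hasArity_I 1
  | succ m ih =>
    rw [powB_succ']
    exact ih.succ.comp hasArity_B

theorem hasArity_bul_comp_powB (m : ℕ) (a : A) : HasArity m 1 (bul a ⊚ powB A m) := by
  have h := ((hasArity_bul a).add m)
  rw [Nat.zero_add, Nat.add_comm] at h
  exact h.comp (hasArity_powB m)

theorem bul_comp_powB_app_I (m : ℕ) (a : A) : (bul a ⊚ powB A m) ⬝ I = a := by
  rw [comp_app, powB_I, bul_app, I_app]

/-- Extensionality expands `(a · I)•` to `I• ∘ a• ∘ B`. The arity of `a` turns `a• ∘ Bᵐ⁺¹` into `(B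
a) ∘ B`, the exchange law moves `I•` past `B a`, and `I• ∘ B = I` leaves `a`. -/
theorem HasArity.eq_bul_comp_powB {m : ℕ} {a : A} (h : HasArity m 1 a) :
    a = bul (a ⬝ I) ⊚ powB A m := by
  have h1 : bul (a ⬝ I) = bul I ⊚ bul a ⊚ B := IsExtensional.app_bul a I
  have h2 : bul a ⊚ B ⊚ powB A m = (B ⬝ a) ⊚ B ⊚ I := h
  have h3 : bul (I : A) ⊚ B = I := IsExtensional.I_bul
  rw [h1, comp_assoc, comp_assoc, h2, comp_left_comm_of (bul_exchange I a), comp_I, h3, comp_I]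

end Arity

/-! ### The isomorphism `U ≅ [U, U]` for `U = C_A(-, 1)` -/

noncomputable section Repr

open IsBIBulletAlgebra

variable {A : Type u} [BIBulletStr A] [IsExtensional A]

/-- The element of `A` underlying an element of `C_A(-, 1)`. -/
def elt {c : (PRO A)ᵒᵖ} (x : (reprOne A).functor.obj c) : A := PRO.Hom.val x

/-- The universal element of `C_A(-, 1)`. -/
def reprId (A : Type u) [BIBulletStr A] [IsExtensional A] :
    (reprOne A).functor.obj (op ⟨1⟩) := 𝟙 (⟨1⟩ : PRO A)

/-- The element of `C_A(m, 1)` with code `a`. -/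
def decode (c : (PRO A)ᵒᵖ) (a : A) : (reprOne A).functor.obj c :=
  PRO.Hom.mk (bul a ⊚ powB A c.unop.num) (hasArity_bul_comp_powB _ a)

theorem elt_reprId : elt (reprId A) = I := rfl

theorem elt_map {c d : (PRO A)ᵒᵖ} (f : c ⟶ d) (x : (reprOne A).functor.obj c) :
    elt ((reprOne A).functor.map f x) = PRO.Hom.val f.unop ⊚ elt x := rfl

/-- Each of the sets `C_A(m, 1)` is in bijection with `A`. -/
def codeEquiv (c : (PRO A)ᵒᵖ) : (reprOne A).functor.obj c ≃ A where
  toFun x := elt x ⬝ I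
  invFun a := decode c a
  left_inv x := PRO.hom_ext (PRO.Hom.hasArity x).eq_bul_comp_powB.symm
  right_inv a := bul_comp_powB_app_I _ a

/-- The natural family of maps `C_A(m, 1) × C_A(n, 1) ⟶ C_A(m + n, 1)` given by the arrow
`B : 2 ⟶ 1` of `C_A`. -/
def reprAppNatTrans (A : Type u) [BIBulletStr A] [IsExtensional A] :
    externalProduct (reprOne A).functor (reprOne A).functor ⟶
      tensor (PRO A)ᵒᵖ ⋙ (reprOne A).functor where
  app p := ↾fun z => (show (unop p.1 ⊗ unop p.2 ⟶ (⟨1⟩ : PRO A)) from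
    ((show (unop p.1 ⟶ (⟨1⟩ : PRO A)) from z.1) ⊗ₘ
      (show (unop p.2 ⟶ (⟨1⟩ : PRO A)) from z.2)) ≫ ⟨B, hasArity_B⟩)
  naturality p q f := by
    ext z
    exact (congrArg (· ≫ _) (MonoidalCategory.tensorHom_comp_tensorHom
      f.1.unop f.2.unop (show (unop p.1 ⟶ (⟨1⟩ : PRO A)) from z.1)
      (show (unop p.2 ⟶ (⟨1⟩ : PRO A)) from z.2)).symm).trans (Category.assoc _ _ _)

/-- The map `U ⊗ U ⟶ U` given by the arrow `B : 2 ⟶ 1` of `C_A`. -/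
def reprApp (A : Type u) [BIBulletStr A] [IsExtensional A] :
    reprOne A ⊗ reprOne A ⟶ reprOne A :=
  DayFunctor.tensorDesc (reprAppNatTrans A)

theorem elt_reprApp {c d : (PRO A)ᵒᵖ} (x : (reprOne A).functor.obj c)
    (y : (reprOne A).functor.obj d) :
    elt ((reprApp A).natTrans.app (c ⊗ d) (pair x y)) = elt x ⊚ (B ⬝ elt y) ⊚ B := by
  have h := types_congr_hom (DayFunctor.η_comp_tensorDesc_app (C := (PRO A)ᵒᵖ) (V := Type u)
    (reprAppNatTrans A) c d)
    (Prod.mk x y)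
  refine (congrArg elt h).trans ?_
  -- The exponent `1` is the target of `x`, by the definition of the tensor product of arrows.
  change (elt x ⊚ (powB A 1 ⬝ elt y)) ⊚ B = _
  rw [powB, powB, comp_I, comp_assoc]

theorem elt_reprApp_app_I {c d : (PRO A)ᵒᵖ} (x : (reprOne A).functor.obj c)
    (y : (reprOne A).functor.obj d) :
    elt ((reprApp A).natTrans.app (c ⊗ d) (pair x y)) ⬝ I = elt x ⬝ elt y := by
  rw [elt_reprApp, comp_app, comp_app, IsExtensional.B_I]
  exact congrArg _ (comp_I _)

theorem elt_reprApp_reprId_app_I {c : (PRO A)ᵒᵖ} (x : (reprOne A).functor.obj c) :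
    elt ((reprApp A).natTrans.app (c ⊗ op ⟨1⟩) (pair x (reprId A))) ⬝ I = elt x ⬝ I :=
  elt_reprApp_app_I x (reprId A)

/-- This is the Yoneda lemma: `U` is represented by `1`, with universal element `reprId`. -/
theorem natTrans_ext_reprId {c : (PRO A)ᵒᵖ}
    {α β : (reprOne A).functor ⟶ tensorLeft c ⋙ (reprOne A).functor}
    (h : α.app (op ⟨1⟩) (reprId A) = β.app (op ⟨1⟩) (reprId A)) : α = β :=
  yonedaEquiv.injective h

/-- Evaluating at `reprId` and then taking the code gives back the code of `x`, and both steps are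
injective on natural transformations. So the inverse sends `α` to the arrow with the same code as
`α` at `reprId`. -/
theorem bijective_partialApp_reprApp (c : (PRO A)ᵒᵖ) :
    Function.Bijective (fun x : (reprOne A).functor.obj c => partialApp (reprApp A) x) := by
  refine ⟨fun x y h => (codeEquiv c).injective ?_, fun α => ?_⟩
  · have h' := congrArg (fun α : (reprOne A).functor ⟶ tensorLeft c ⋙ (reprOne A).functor =>
      elt (c := c ⊗ op ⟨1⟩) (α.app (op ⟨1⟩) (reprId A)) ⬝ I) h
    exact (elt_reprApp_reprId_app_I x).symm.trans (h'.trans (elt_reprApp_reprId_app_I y))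
  · refine ⟨(codeEquiv c).symm (codeEquiv (c ⊗ op ⟨1⟩) (α.app (op ⟨1⟩) (reprId A))),
      natTrans_ext_reprId ((codeEquiv (c ⊗ op ⟨1⟩)).injective ?_)⟩
    exact (elt_reprApp_reprId_app_I _).trans ((codeEquiv c).apply_symm_apply _)

instance isIso_internalHomEquiv_reprApp :
    IsIso (internalHomEquiv (reprOne A) (reprOne A) (reprOne A) (reprApp A)) := by
  have : IsIso ((DayFunctor.equiv (PRO A)ᵒᵖ (Type u)).functor.map
      (internalHomEquiv (reprOne A) (reprOne A) (reprOne A) (reprApp A))) := by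
    rw [NatTrans.isIso_iff_isIso_app]
    intro c
    rw [isIso_iff_bijective]
    exact bijective_partialApp_reprApp c
  exact isIso_of_reflects_iso _ (DayFunctor.equiv (PRO A)ᵒᵖ (Type u)).functor

/-- The isomorphism `U ≅ [U, U]` for `U = C_A(-, 1)`. -/
def reprIso (A : Type u) [BIBulletStr A] [IsExtensional A] :
    reprOne A ≅ ((dayClosedStr (PRO A)ᵒᵖ).ihom (reprOne A)).obj (reprOne A) :=
  show reprOne A ≅ internalHom (reprOne A) (reprOne A) from
    asIso (internalHomEquiv (reprOne A) (reprOne A) (reprOne A) (reprApp A))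

theorem appHom_reprIso : (dayClosedStr (PRO A)ᵒᵖ).appHom (reprIso A) = reprApp A := by
  unfold ClosedStr.appHom
  rw [Equiv.symm_apply_eq, dayClosedStr_homEquiv]
  rfl

/-- Composing `lam t` with `φ` gives the transpose of `t`. Evaluating both at `reprId` gives the
claim, since `φ` followed by this evaluation preserves codes. -/
theorem elt_lam_app_I {F : Presheaf A} (t : F ⊗ reprOne A ⟶ reprOne A) {c : (PRO A)ᵒᵖ}
    (x : F.functor.obj c) :
    elt (((dayClosedStr (PRO A)ᵒᵖ).lam (reprIso A) t).natTrans.app c x) ⬝ I =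
      elt (t.natTrans.app (c ⊗ op ⟨1⟩) (pair x (reprId A))) ⬝ I := by
  have h : (dayClosedStr (PRO A)ᵒᵖ).lam (reprIso A) t ≫ (reprIso A).hom =
      internalHomEquiv (reprOne A) F (reprOne A) t := by
    unfold ClosedStr.lam
    rw [Category.assoc, Iso.inv_hom_id, Category.comp_id, dayClosedStr_homEquiv]
  have h' := congrArg (fun s : F ⟶ internalHom (reprOne A) (reprOne A) =>
    elt (c := c ⊗ op ⟨1⟩) (NatTrans.app (F := (reprOne A).functor)
      (G := tensorLeft c ⋙ (reprOne A).functor) (s.natTrans.app c x) (op ⟨1⟩) (reprId A)) ⬝ I) h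
  exact (elt_reprApp_reprId_app_I _).symm.trans h'

end Repr

/-! ### The induced structure computed on codes -/

noncomputable section Induced

open IsBIBulletAlgebra

variable {A : Type u} [BIBulletStr A] [IsExtensional A]

/-- Intended for the structural isomorphisms of `C_A`, all of which have underlying element `I`:
they can be ignored when only the element of `A` matters. -/
theorem elt_natTrans_app_map {F : Presheaf A} (s : F ⟶ reprOne A) {c d : (PRO A)ᵒᵖ} (f : c ⟶ d)
    (hf : PRO.Hom.val f.unop = I) (x : F.functor.obj c) :
    elt (s.natTrans.app d (F.functor.map f x)) = elt (s.natTrans.app c x) := by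
  rw [natTrans_app_map, elt_map, hf, I_comp]

theorem comp_natTrans_app {F G H : Presheaf A} (s : F ⟶ G) (t : G ⟶ H) {c : (PRO A)ᵒᵖ}
    (x : F.functor.obj c) :
    (s ≫ t).natTrans.app c x = t.natTrans.app c (s.natTrans.app c x) := rfl

theorem iso_inv_comp_app_hom_app {F G H : Presheaf A} (i : F ≅ G) (s : F ⟶ H) {c : (PRO A)ᵒᵖ}
    (x : F.functor.obj c) :
    (i.inv ≫ s).natTrans.app c (i.hom.natTrans.app c x) = s.natTrans.app c x :=
  types_congr_hom (congrArg (fun t => t.natTrans.app c) (i.hom_inv_id_assoc s)) x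

/-- The element of `C_A(0, 1)` corresponding to a map from the unit to `U = C_A(-, 1)`. -/
def point (f : 𝟙_ (Presheaf A) ⟶ reprOne A) : (reprOne A).functor.obj (𝟙_ (PRO A)ᵒᵖ) :=
  f.natTrans.app _ (unitElt (PRO A)ᵒᵖ)

/-- The maps from the unit to `U = C_A(-, 1)` are in bijection with the elements of `A`. -/
def codeHomEquiv (A : Type u) [BIBulletStr A] [IsExtensional A] :
    (𝟙_ (Presheaf A) ⟶ reprOne A) ≃ A :=
  (unitHomEquiv (reprOne A)).trans (codeEquiv _)

/-- An arrow `0 ⟶ 1` with code `a` is `a• ∘ B⁰ = a•`. -/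
theorem elt_point (f : 𝟙_ (Presheaf A) ⟶ reprOne A) :
    elt (point f) = bul (codeHomEquiv A f) :=
  (PRO.Hom.hasArity (point f)).eq_bul_comp_powB.trans (comp_I _)

theorem elt_leftUnitor_inv_unitElt (s : 𝟙_ (Presheaf A) ⊗ 𝟙_ (Presheaf A) ⟶ reprOne A) :
    elt (point ((λ_ (𝟙_ (Presheaf A))).inv ≫ s)) =
      elt (s.natTrans.app _ (pair (unitElt (PRO A)ᵒᵖ) (unitElt (PRO A)ᵒᵖ))) := by
  have h := elt_natTrans_app_map ((λ_ (𝟙_ (Presheaf A))).inv ≫ s)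
    (λ_ (𝟙_ (PRO A)ᵒᵖ)).inv rfl (unitElt (PRO A)ᵒᵖ)
  rw [← leftUnitor_pair] at h
  exact h.symm.trans (congrArg elt (iso_inv_comp_app_hom_app (λ_ (𝟙_ (Presheaf A))) s _))

theorem elt_rightUnitor_inv {F : Presheaf A} (s : F ⊗ 𝟙_ (Presheaf A) ⟶ reprOne A)
    {c : (PRO A)ᵒᵖ} (x : F.functor.obj c) :
    elt (((ρ_ F).inv ≫ s).natTrans.app c x) =
      elt (s.natTrans.app _ (pair x (unitElt (PRO A)ᵒᵖ))) := by
  have h := elt_natTrans_app_map ((ρ_ F).inv ≫ s) (ρ_ c).inv rfl x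
  rw [← rightUnitor_pair] at h
  exact h.symm.trans (congrArg elt (iso_inv_comp_app_hom_app (ρ_ F) s _))

theorem elt_leftUnitor_hom {F : Presheaf A} (s : F ⟶ reprOne A)
    {c : (PRO A)ᵒᵖ} (x : F.functor.obj c) :
    elt (((λ_ F).hom ≫ s).natTrans.app _ (pair (unitElt (PRO A)ᵒᵖ) x)) =
      elt (s.natTrans.app c x) := by
  refine Eq.trans ?_ (elt_natTrans_app_map s (λ_ c).inv rfl x)
  rw [← leftUnitor_pair]
  rfl

theorem elt_associator_hom {F G H : Presheaf A} (s : F ⊗ G ⊗ H ⟶ reprOne A)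
    {c d e : (PRO A)ᵒᵖ} (x : F.functor.obj c) (y : G.functor.obj d) (z : H.functor.obj e) :
    elt (((α_ F G H).hom ≫ s).natTrans.app _ (pair (pair x y) z)) =
      elt (s.natTrans.app _ (pair x (pair y z))) := by
  refine Eq.trans ?_ (elt_natTrans_app_map s (α_ c d e).inv rfl _)
  rw [← associator_pair]
  rfl

/-- The structure induced on the maps from the unit to `U = C_A(-, 1)`. -/
@[reducible]
def reprStr (A : Type u) [BIBulletStr A] [IsExtensional A] :
    BIBulletStr (𝟙_ (Presheaf A) ⟶ reprOne A) :=
  (dayClosedStr (PRO A)ᵒᵖ).inducedStr (reprIso A)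

attribute [local instance] reprStr

theorem codeHomEquiv_app (a b : 𝟙_ (Presheaf A) ⟶ reprOne A) :
    codeHomEquiv A (a ⬝ b) = codeHomEquiv A a ⬝ codeHomEquiv A b := by
  change elt (point ((λ_ _).inv ≫ (a ⊗ₘ b) ≫ (dayClosedStr (PRO A)ᵒᵖ).appHom (reprIso A))) ⬝ I = _
  rw [appHom_reprIso, elt_leftUnitor_inv_unitElt, comp_natTrans_app,
    tensorHom_pair, elt_reprApp_app_I]
  change elt (point a) ⬝ elt (point b) = _
  -- With `a`, `b` standing for the codes, `a• · b• = b• · a = a · b`.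
  rw [elt_point, elt_point, bul_app, bul_app]

theorem codeHomEquiv_I : codeHomEquiv A I = I := by
  refine (elt_lam_app_I _ _).trans ?_
  rw [← Category.comp_id (λ_ (reprOne A)).hom, elt_leftUnitor_hom]
  exact I_app I

theorem codeHomEquiv_bul (a : 𝟙_ (Presheaf A) ⟶ reprOne A) :
    codeHomEquiv A (bul a) = bul (codeHomEquiv A a) := by
  refine (elt_lam_app_I _ _).trans ?_
  rw [elt_leftUnitor_hom, elt_rightUnitor_inv, appHom_reprIso, comp_natTrans_app,
    whiskerLeft_pair, elt_reprApp_app_I, elt_reprId, I_app]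
  exact elt_point a

theorem codeHomEquiv_lam (t : 𝟙_ (Presheaf A) ⊗ reprOne A ⟶ reprOne A) :
    codeHomEquiv A ((dayClosedStr (PRO A)ᵒᵖ).lam (reprIso A) t) =
      elt (t.natTrans.app _ (pair (unitElt (PRO A)ᵒᵖ) (reprId A))) ⬝ I :=
  elt_lam_app_I _ _

theorem codeHomEquiv_B : codeHomEquiv A B = B := by
  have h : (B : 𝟙_ (Presheaf A) ⟶ reprOne A) = (dayClosedStr _).lam (reprIso A)
      ((dayClosedStr _).lam (reprIso A) ((dayClosedStr _).lam (reprIso A)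
        (((λ_ _).hom ▷ _) ▷ _ ≫ (α_ _ _ _).hom ≫
          reprOne A ◁ (dayClosedStr _).appHom (reprIso A) ≫
            (dayClosedStr _).appHom (reprIso A)))) := rfl
  -- Each of the three abstractions supplies a `reprId` as argument. What remains is `I` applied to
  -- the element `I ∘ (B · I) ∘ B = B` of `app(id, id)`.
  rw [h, codeHomEquiv_lam, elt_lam_app_I, elt_lam_app_I, appHom_reprIso,
    comp_natTrans_app, whiskerRight_pair, whiskerRight_pair, elt_associator_hom,
    comp_natTrans_app, whiskerLeft_pair, elt_reprApp_app_I, elt_reprApp, leftUnitor_pair, elt_map,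
    elt_reprId, I_comp, comp_I, IsExtensional.B_I, I_comp]
  exact I_app B

/-- The structure induced on the maps from the unit to `U = C_A(-, 1)` is isomorphic to `A`. -/
def codeAlgIso (A : Type u) [BIBulletStr A] [IsExtensional A] :
    AlgIso (𝟙_ (Presheaf A) ⟶ reprOne A) A where
  toEquiv := codeHomEquiv A
  map_app := codeHomEquiv_app
  map_B := codeHomEquiv_B
  map_I := codeHomEquiv_I
  map_bul := codeHomEquiv_bul

end Induced

end PlanarAlg

/-- Every extensional `BI(_)•`-algebra `A` is isomorphic to the extensional `BI(_)•`-algebra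
`D(I, U)` induced by an object `U ≅ [U, U]` of a monoidal closed category `D`, where `D` is the
category of presheaves on `C_A` with Day convolution, and `U = C_A(-, 1)`. -/
theorem mainTheorem4 (A : Type u) [PlanarAlg.BIBulletStr A] [PlanarAlg.IsExtensional A] :
    ∃ (H : PlanarAlg.ClosedStr (PlanarAlg.Presheaf A))
      (φ : PlanarAlg.reprOne A ≅ (H.ihom (PlanarAlg.reprOne A)).obj (PlanarAlg.reprOne A)),
      letI : PlanarAlg.BIBulletStr (𝟙_ (PlanarAlg.Presheaf A) ⟶ PlanarAlg.reprOne A) :=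
        H.inducedStr φ
      PlanarAlg.IsExtensional (𝟙_ (PlanarAlg.Presheaf A) ⟶ PlanarAlg.reprOne A) ∧
        Nonempty (PlanarAlg.AlgIso A (𝟙_ (PlanarAlg.Presheaf A) ⟶ PlanarAlg.reprOne A)) := by
  let := PlanarAlg.reprStr A
  exact ⟨PlanarAlg.dayClosedStr (PlanarAlg.PRO A)ᵒᵖ, PlanarAlg.reprIso A,
    PlanarAlg.IsExtensional.of_algIso (PlanarAlg.codeAlgIso A),
    ⟨(PlanarAlg.codeAlgIso A).symm⟩⟩
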